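/- Let $\mathbb{D}\in\{\mathbb{R},\mathbb{C},\mathbb{H}\}$, let $k,l\ge 0$ be integers, $n=k+l$, and let ${\rm J}={\rm diag}({\rm Id}_k,-{\rm Id}_l)\in{\rm Mat}(n\times n,\mathbb{D})$. Write ${\rm X}^*$ for the conjugate transpose of a matrix. Let $\mathfrak{p}_{\rm J}=\{{\rm X}\in{\rm Mat}(n\times n,\mathbb{D}) : {\rm J}{\rm X}^*{\rm J}={\rm X}\}$ be the space of ${\rm J}$-Hermitian matrices and let $\mathscr{P}_{\rm J}$ be the set of those ${\rm X}\in\mathfrak{p}_{\rm J}$ for which the Hermitian matrix ${\rm J}{\rm X}$ is positive definite. Put ${\rm X}\bullet{\rm Y}={\rm X}{\rm J}{\rm Y}$. The map $\exp_{\rm J}({\rm X})={\rm J}\exp({\rm J}{\rm X})$ is a bijection from $\mathfrak{p}_{\rm J}$ onto $\mathscr{P}_{\rm J}$ with inverse $\log_{\rm J}$; for ${\rm X}\in\mathscr{P}_{\rm J}$ and $t\in\mathbb{R}$ put ${\rm X}^t_{\rm J}=\exp_{\rm J}(t\log_{\rm J}({\rm X}))\in\mathscr{P}_{\rm J}$.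 For ${\rm X},{\rm Y}\in\mathscr{P}_{\rm J}$ write ${\rm X}\preceq_{\rm J}{\rm Y}$ if ${\rm J}{\rm Y}-{\rm J}{\rm X}$ is positive semidefinite, and write $0\prec_{\rm J}{\rm Y}$ if ${\rm J}{\rm Y}$ is positive definite. **Proposition (${\rm J}$-Furuta inequality).** For all ${\rm A},{\rm B}\in\mathscr{P}_{\rm J}$ and all real $p\ge 0$ and $r\ge 1$, if $0\prec_{\rm J}{\rm B}\preceq_{\rm J}{\rm A}$, then ${\rm A}^{r/2}_{\rm J}\bullet{\rm B}^p_{\rm J}\bullet{\rm A}^{r/2}_{\rm J}$ belongs to $\mathscr{P}_{\rm J}$ and $$\left({\rm A}^{r/2}_{\rm J}\bullet{\rm B}^p_{\rm J}\bullet{\rm A}^{r/2}_{\rm J}\right)_{\rm J}^{r/(r+p)}\preceq_{\rm J}{\rm A}^r_{\rm J}.$$ -/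

import Mathlib

open scoped Quaternion

namespace JCone

/-- Square matrices of size `k + l` with entries in `D`, in block form. -/
abbrev Mat (k l : ℕ) (D : Type) : Type := Matrix (Fin k ⊕ Fin l) (Fin k ⊕ Fin l) D

section

variable {k l : ℕ} {D : Type} [NormedDivisionRing D] [NormedAlgebra ℝ D] [StarRing D]

/-- The signature matrix `J = diag(Id_k, -Id_l)`. -/
def J : Mat k l D := Matrix.fromBlocks 1 0 0 (-1)

/-- The adjoint `X ↦ J X* J` with respect to the indefinite form `x* J y`. -/
def sharp (X : Mat k l D) : Mat k l D := J * X.conjTranspose * J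

/-- The standard positive form `⟨u, v⟩ = u* v = ∑ i, (conj u_i) v_i` on `D ^ n`. -/
def form (u v : Fin k ⊕ Fin l → D) : D := star u ⬝ᵥ v

/-- The Hermitian matrices, `X = X*`. -/
def herm (k l : ℕ) (D : Type) [NormedDivisionRing D] [StarRing D] : Set (Mat k l D) :=
  {X | X.IsHermitian}

/-- The `J`-Hermitian matrices, `X = J X* J`. -/
def hermJ (k l : ℕ) (D : Type) [NormedDivisionRing D] [StarRing D] : Set (Mat k l D) :=
  {X | sharp X = X}

/-- The cone `𝒫` of positive (definite) Hermitian matrices: `⟨X u, u⟩` is a positive real number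
for every nonzero `u`. -/
def posCone (k l : ℕ) (D : Type) [NormedDivisionRing D] [NormedAlgebra ℝ D] [StarRing D] :
    Set (Mat k l D) :=
  {X | X ∈ herm k l D ∧
    ∀ u : Fin k ⊕ Fin l → D, u ≠ 0 → ∃ c : ℝ, 0 < c ∧ form (X.mulVec u) u = algebraMap ℝ D c}

/-- The cone `𝒫₀` of positive semidefinite Hermitian matrices: `⟨X u, u⟩` is a nonnegative real
number for every `u`. -/
def semiCone (k l : ℕ) (D : Type) [NormedDivisionRing D] [NormedAlgebra ℝ D] [StarRing D] :
    Set (Mat k l D) :=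
  {X | X ∈ herm k l D ∧
    ∀ u : Fin k ⊕ Fin l → D, ∃ c : ℝ, 0 ≤ c ∧ form (X.mulVec u) u = algebraMap ℝ D c}

/-- The cone `𝒫_J` of `J`-positive matrices. -/
def posConeJ (k l : ℕ) (D : Type) [NormedDivisionRing D] [NormedAlgebra ℝ D] [StarRing D] :
    Set (Mat k l D) :=
  {X | X ∈ hermJ k l D ∧ J * X ∈ posCone k l D}

/-- The `J`-product `X • Y = X J Y`. -/
def mulJ (X Y : Mat k l D) : Mat k l D := X * J * Y

/-- The `J`-exponential `exp_J X = J exp (J X)`. -/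
noncomputable def expJ (X : Mat k l D) : Mat k l D := J * NormedSpace.exp (J * X)

/-- The `J`-logarithm, the inverse of the bijection `exp_J` from the `J`-Hermitian matrices onto
`𝒫_J` (meaningful on `𝒫_J` only). -/
noncomputable def logJ (X : Mat k l D) : Mat k l D := Function.invFunOn expJ (hermJ k l D) X

/-- The `J`-power `exp_J (t log_J X)` of `X ∈ 𝒫_J`, for real `t`. -/
noncomputable def powJ (X : Mat k l D) (t : ℝ) : Mat k l D := expJ (t • logJ X)

/-- The `J`-Loewner order on `𝒫_J`: both matrices lie in `𝒫_J`, and `J Y - J X` is positive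
semidefinite. -/
def LeJ (X Y : Mat k l D) : Prop :=
  X ∈ posConeJ k l D ∧ Y ∈ posConeJ k l D ∧ J * Y - J * X ∈ semiCone k l D

/-- The strict relation `X ≺_J Y`: `J Y - J X` is positive definite. Here `X`, `Y` need not be in
`𝒫_J`, so that `0 ≺_J Y` makes sense. -/
def LtJ (X Y : Mat k l D) : Prop := J * Y - J * X ∈ posCone k l D

end

end JCone

infixl:70 " •ⱼ " => JCone.mulJ
infix:50 " ⪯ⱼ " => JCone.LeJ
infix:50 " ≺ⱼ " => JCone.LtJ

open JCone

/-! ### Furuta's inequality in a unital C*-algebra. -/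

section Furuta

variable {A : Type*} [CStarAlgebra A] [PartialOrder A] [StarOrderedRing A]

/-! Left multiplication by `J` turns J-products and J-powers into ordinary ones, and the J-order
into the Loewner order. A faithful real *-representation of the `D`-matrices on complex matrices,
preserving and reflecting positivity, then reduces all three cases to Furuta's inequality in a
C*-algebra.

That inequality rests on Löwner–Heinz and the identity `(x x*)^t = x (x* x)^(t-1) x*`
(`CFC.rpow_mul_star_self`), which settle small `r` (`CFC.furuta_of_le_one`); the result is then
bootstrapped to all `r`. Positivity transfers because the range of the representation is closed
under real functional calculus (`exists_map_eq_cfc`), so square roots and negative parts of images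
again come from `D`-matrices. -/

lemma IsStrictlyPositive.rpow_const {a : A} (ha : IsStrictlyPositive a) (t : ℝ) :
    IsStrictlyPositive (a ^ t) :=
  (ha.isUnit.cfcRpow t ha.nonneg).isStrictlyPositive CFC.rpow_nonneg

lemma CFC.rpow_mul_of_isStrictlyPositive {a : A} (ha : IsStrictlyPositive a) (s t : ℝ) :
    (a ^ s) ^ t = a ^ (s * t) := by
  rcases eq_or_ne s 0 with rfl | hs
  · simp [CFC.rpow_zero a ha.nonneg]
  · exact CFC.rpow_rpow a s t hs ha

/-- Löwner–Heinz with exponent `-t`, followed by inversion, which reverses the order. -/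
lemma CFC.rpow_le_rpow_of_nonpos {a b : A} (ha : IsStrictlyPositive a) (hab : a ≤ b) {t : ℝ}
    (ht₁ : -1 ≤ t) (ht₀ : t ≤ 0) : b ^ t ≤ a ^ t := by
  have hb := ha.of_le hab
  have h := CStarAlgebra.rpow_neg_one_le_rpow_neg_one
    (CFC.rpow_le_rpow (p := -t) ⟨by linarith, by linarith⟩ hab) (ha.rpow_const _)
  simpa [CFC.rpow_mul_of_isStrictlyPositive, ha, hb] using h

lemma Unitary.rpow_conj (u : unitary A) {c : A} (hc : IsStrictlyPositive c) (t : ℝ) :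
    ((u : A) * c * star (u : A)) ^ t = u * c ^ t * star (u : A) := by
  have hc0 : (0 : NNReal) ∉ spectrum NNReal c := spectrum.zero_notMem _ hc.isUnit
  have h := StarAlgHomClass.map_cfc (S := ℂ) (Unitary.conjStarAlgAut ℂ A u)
    (fun x : NNReal ↦ x ^ t) c
    (hf := fun x hx ↦ (NNReal.continuousAt_rpow_const (.inl (by
      rintro rfl; exact hc0 hx))).continuousWithinAt)
    (hφ := by
      change Continuous fun x : A ↦ (u : A) * x * star (u : A)
      fun_prop) (ha := hc.nonneg)
    (hφa := by simpa using star_right_conjugate_nonneg hc.nonneg (u : A))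
  simpa [CFC.rpow_def] using h.symm

/-- Polar decomposition: with `c = x* x`, the element `u = x c^(-1/2)` is unitary and `x x* = u c
u*`, so the power can be taken on `c`. -/
lemma CFC.rpow_mul_star_self {x : A} (hx : IsUnit x) (t : ℝ) :
    (x * star x) ^ t = x * (star x * x) ^ (t - 1) * star x := by
  set c := star x * x with hc
  have hcp : IsStrictlyPositive c :=
    (hx.star.mul hx).isStrictlyPositive (star_mul_self_nonneg x)
  have hcs (s : ℝ) : star (c ^ s) = c ^ s := (CFC.rpow_nonneg (a := c)).isSelfAdjoint.star_eq
  have hadd (s s' : ℝ) : c ^ s * c ^ s' = c ^ (s + s') := (CFC.rpow_add hcp.isUnit).symm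
  have hc1 : c ^ (1 : ℝ) = c := CFC.rpow_one c hcp.nonneg
  have hc0 : c ^ (0 : ℝ) = 1 := CFC.rpow_zero c hcp.nonneg
  set u := x * c ^ (-(1 / 2) : ℝ) with hu
  have hstar : star u = c ^ (-(1 / 2) : ℝ) * star x := by simp [hu, hcs]
  have hu1 : star u * u = 1 := by
    rw [hstar, hu, mul_assoc, ← mul_assoc (star x), ← hc, ← mul_assoc]
    nth_rw 2 [← hc1]
    rw [hadd, hadd, ← hc0]
    norm_num
  have huu : IsUnit u := hx.mul (hcp.rpow_const _).isUnit
  have hu2 : u * star u = 1 := by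
    have h := huu.mul_left_inj.1 (show u * star u * u = 1 * u by rw [mul_assoc, hu1]; simp)
    exact h
  have hmid (s : ℝ) : u * c ^ s * star u = x * c ^ (s - 1) * star x := by
    rw [hstar, hu]
    have : s - 1 = -(1 / 2) + s + -(1 / 2) := by ring
    rw [this, ← hadd, ← hadd]
    simp only [mul_assoc]
  have h := Unitary.rpow_conj ⟨u, Unitary.mem_iff.2 ⟨hu1, hu2⟩⟩ hcp t
  have h1 := hmid 1
  rw [hc1, sub_self, hc0, mul_one] at h1
  rw [← hmid t, ← h1]
  exact h

lemma CFC.conjugate_rpow_pos {a b : A} (ha : IsStrictlyPositive a) (hb : IsStrictlyPositive b)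
    (s p : ℝ) : IsStrictlyPositive (a ^ s * b ^ p * a ^ s) := by
  refine (((ha.rpow_const s).isUnit.mul (hb.rpow_const p).isUnit).mul
    (ha.rpow_const s).isUnit).isStrictlyPositive ?_
  exact conjugate_nonneg_of_nonneg CFC.rpow_nonneg CFC.rpow_nonneg

/-- The best-exponent Furuta inequality for small `r`. -/
lemma CFC.furuta_of_le_one {a b : A} (hb : IsStrictlyPositive b) (hba : b ≤ a) {p r : ℝ}
    (hp : 1 ≤ p) (hr₀ : 0 ≤ r) (hr₁ : r ≤ 1) :
    (a ^ (r / 2) * b ^ p * a ^ (r / 2)) ^ ((1 + r) / (p + r)) ≤ a ^ (1 + r) := by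
  have ha := hb.of_le hba
  have hsa (s : ℝ) : star (a ^ s) = a ^ s := (CFC.rpow_nonneg (a := a)).isSelfAdjoint.star_eq
  have hsb (s : ℝ) : star (b ^ s) = b ^ s := (CFC.rpow_nonneg (a := b)).isSelfAdjoint.star_eq
  have hadda (s s' : ℝ) : a ^ s * a ^ s' = a ^ (s + s') := (CFC.rpow_add ha.isUnit).symm
  have haddb (s s' : ℝ) : b ^ s * b ^ s' = b ^ (s + s') := (CFC.rpow_add hb.isUnit).symm
  have hpr : 0 < p + r := by linarith
  set x := a ^ (r / 2) * b ^ (p / 2) with hx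
  have hxu : IsUnit x := (ha.rpow_const _).isUnit.mul (hb.rpow_const _).isUnit
  have hsx : star x = b ^ (p / 2) * a ^ (r / 2) := by simp [hx, hsa, hsb]
  have hxx : x * star x = a ^ (r / 2) * b ^ p * a ^ (r / 2) := by
    rw [hsx, hx, mul_assoc, ← mul_assoc (b ^ (p / 2)), haddb, add_halves, mul_assoc]
  have hxx' : star x * x = b ^ (p / 2) * a ^ r * b ^ (p / 2) := by
    rw [hsx, hx, mul_assoc, ← mul_assoc (a ^ (r / 2)), hadda, add_halves, mul_assoc]
  -- Löwner–Heinz gives `b^r ≤ a^r`, where `r ≤ 1` is needed; conjugate by `b^(p/2)`.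
  have hlow : b ^ (p + r) ≤ star x * x := by
    have h := conjugate_le_conjugate_of_nonneg (CFC.rpow_le_rpow (p := r) ⟨hr₀, hr₁⟩ hba)
      (CFC.rpow_nonneg (a := b) (y := p / 2))
    rw [haddb, haddb] at h
    rw [hxx']
    convert h using 2
    ring
  have hexp : (1 + r) / (p + r) - 1 = (1 - p) / (p + r) := by field_simp; ring
  -- The exponent lies in `[-1, 0]` because `p ≥ 1` and `r ≥ 0`, so the power reverses `hlow`.
  have hmid : (star x * x) ^ ((1 - p) / (p + r)) ≤ b ^ (1 - p) := by
    have h := CFC.rpow_le_rpow_of_nonpos (hb.rpow_const _) hlow (t := (1 - p) / (p + r))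
      (by rw [le_div_iff₀ hpr]; linarith) (div_nonpos_of_nonpos_of_nonneg (by linarith) hpr.le)
    rwa [CFC.rpow_mul_of_isStrictlyPositive hb, mul_div_cancel₀ _ hpr.ne'] at h
  rw [← hxx, CFC.rpow_mul_star_self hxu, hexp]
  calc x * (star x * x) ^ ((1 - p) / (p + r)) * star x
      ≤ x * b ^ (1 - p) * star x := star_right_conjugate_le_conjugate hmid x
    _ = a ^ (r / 2) * b * a ^ (r / 2) := by
      have : b ^ (p / 2) * b ^ (1 - p) * b ^ (p / 2) = b := by
        rw [haddb, haddb]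
        convert CFC.rpow_one b hb.nonneg using 2
        ring
      conv_rhs => rw [← this]
      rw [hsx, hx]
      simp only [mul_assoc]
    _ ≤ a ^ (r / 2) * a * a ^ (r / 2) := conjugate_le_conjugate_of_nonneg hba CFC.rpow_nonneg
    _ = a ^ (1 + r) := by
      nth_rw 2 [← CFC.rpow_one a ha.nonneg]
      rw [hadda, hadda]
      congr 1
      ring

/-- The best-exponent Furuta inequality for `p ≥ 1`. -/
lemma CFC.furuta_of_one_le {p : ℝ} {a b : A} (hb : IsStrictlyPositive b) (hba : b ≤ a)
    (hp : 1 ≤ p) {r : ℝ} (hr : 0 ≤ r) :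
    (a ^ (r / 2) * b ^ p * a ^ (r / 2)) ^ ((1 + r) / (p + r)) ≤ a ^ (1 + r) := by
  have ha := hb.of_le hba
  have hadda (s s' : ℝ) : a ^ s * a ^ s' = a ^ (s + s') := (CFC.rpow_add ha.isUnit).symm
  obtain ⟨n, hn⟩ := exists_nat_ge r
  induction n generalizing r with
  | zero => exact furuta_of_le_one hb hba hp hr (hn.trans (by simp))
  | succ n ih =>
    rcases le_total r 1 with hr₁ | hr₁
    · exact furuta_of_le_one hb hba hp hr hr₁
    push_cast at hn
    -- The case `s` yields a new ordered pair, with `a^(1+s)` on top. The case `r = 1` for that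
    -- pair, with exponent `(p+s)/(1+s)`, undoes the outer power; the factors `a^((1+s)/2)` and
    -- `a^(s/2)` merge into `a^((1+2s)/2)`.
    obtain ⟨s, rfl⟩ : ∃ s, r = 1 + 2 * s := ⟨(r - 1) / 2, by ring⟩
    have hs : 0 ≤ s := by linarith
    have hps : 0 < p + s := by linarith
    have hpos := CFC.conjugate_rpow_pos ha hb (s / 2) p
    have h := furuta_of_le_one (hpos.rpow_const _) (ih hs (by linarith))
      (p := (p + s) / (1 + s)) (r := 1) (by rw [le_div_iff₀ (by linarith)]; linarith)
      zero_le_one le_rfl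
    rw [CFC.rpow_mul_of_isStrictlyPositive hpos, CFC.rpow_mul_of_isStrictlyPositive ha,
      CFC.rpow_mul_of_isStrictlyPositive ha,
      show (1 + s) / (p + s) * ((p + s) / (1 + s)) = 1 by field_simp,
      CFC.rpow_one _ hpos.nonneg, ← mul_assoc, ← mul_assoc, hadda, mul_assoc, hadda] at h
    convert h using 2
    · congr 2
      · congr 2
        ring
      · ring
    · field_simp
      ring
    · ring

/-- **Furuta's inequality**, in the form with exponent `r / (r + p)`. -/
theorem CFC.furuta {a b : A} (hb : IsStrictlyPositive b) (hba : b ≤ a) {p r : ℝ}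
    (hp : 0 ≤ p) (hr : 0 < r) :
    (a ^ (r / 2) * b ^ p * a ^ (r / 2)) ^ (r / (r + p)) ≤ a ^ r := by
  have ha := hb.of_le hba
  have hadda (s s' : ℝ) : a ^ s * a ^ s' = a ^ (s + s') := (CFC.rpow_add ha.isUnit).symm
  have hpos := CFC.conjugate_rpow_pos ha hb (r / 2) p
  -- For `p ≤ 1`, two uses of Löwner–Heinz suffice; for `p ≥ 1`, raise the best-exponent inequality
  -- to the power `r/(1+r) ≤ 1`.
  rcases le_total p 1 with hp₁ | hp₁
  · have h := conjugate_le_conjugate_of_nonneg (CFC.rpow_le_rpow (p := p) ⟨hp, hp₁⟩ hba)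
      (CFC.rpow_nonneg (a := a) (y := r / 2))
    rw [hadda, hadda] at h
    have h' := CFC.rpow_le_rpow (p := r / (r + p))
      ⟨by positivity, by rw [div_le_one (by positivity)]; linarith⟩ h
    rw [CFC.rpow_mul_of_isStrictlyPositive ha] at h'
    convert h' using 2
    field_simp
    ring
  · have h := CFC.rpow_le_rpow (p := r / (1 + r))
      ⟨by positivity, by rw [div_le_one (by positivity)]; linarith⟩
      (CFC.furuta_of_one_le hb hba hp₁ hr.le)
    rw [CFC.rpow_mul_of_isStrictlyPositive ha, CFC.rpow_mul_of_isStrictlyPositive hpos] at h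
    convert h using 2
    · field_simp
      ring
    · field_simp

lemma CFC.exp_smul_eq_rpow {h : A} (hh : IsSelfAdjoint h) (t : ℝ) :
    NormedSpace.exp (t • h) = NormedSpace.exp h ^ t := by
  rw [← CFC.real_exp_eq_normedSpace_exp ((IsSelfAdjoint.all t).smul hh),
    ← CFC.real_exp_eq_normedSpace_exp hh, CFC.cfc_rpow (fun x _ ↦ Real.exp_pos x),
    ← cfc_comp_smul t Real.exp h]
  congr 1
  ext x
  rw [← Real.exp_mul, smul_eq_mul, mul_comm]

end Furuta

/-! ### Removing `J` by left multiplication. -/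

namespace JCone

section

variable {k l : ℕ} {D : Type} [NormedDivisionRing D]

lemma J_mul_J : (J * J : Mat k l D) = 1 := by
  simp [J, Matrix.fromBlocks_multiply]

lemma J_mul_cancel_left (X : Mat k l D) : J * (J * X) = X := by
  rw [← mul_assoc, J_mul_J, one_mul]

lemma J_mul_expJ (X : Mat k l D) : J * expJ X = NormedSpace.exp (J * X) :=
  J_mul_cancel_left _

variable [StarRing D]

lemma J_conjTranspose : (J : Mat k l D).conjTranspose = J := by
  simp [J, Matrix.fromBlocks_conjTranspose]

lemma mem_hermJ_iff {X : Mat k l D} : X ∈ hermJ k l D ↔ (J * X).IsHermitian := by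
  have h : (J * X).conjTranspose = X.conjTranspose * J := by
    rw [Matrix.conjTranspose_mul, J_conjTranspose]
  rw [Matrix.IsHermitian, h]
  change J * X.conjTranspose * J = X ↔ _
  constructor
  · intro hX
    conv_rhs => rw [← hX, mul_assoc, J_mul_cancel_left]
  · intro hX
    rw [mul_assoc, hX, J_mul_cancel_left]

lemma mem_posConeJ_iff [NormedAlgebra ℝ D] {X : Mat k l D} : X ∈ posConeJ k l D ↔ J * X ∈ posCone k l D :=
  ⟨fun h ↦ h.2, fun h ↦ ⟨mem_hermJ_iff.2 h.1, h⟩⟩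

end

open scoped ComplexOrder Matrix.Norms.L2Operator MatrixOrder

/-! ### The form `u* v` and the positive cones over `D`. -/

section Form

variable {k l : ℕ} {D : Type} [NormedDivisionRing D] [NormedAlgebra ℝ D] [StarRing D]

omit [NormedAlgebra ℝ D] in
lemma form_mulVec_left (X : Mat k l D) (u v : Fin k ⊕ Fin l → D) :
    form (X.mulVec u) v = form u (X.conjTranspose.mulVec v) := by
  rw [form, form, Matrix.star_mulVec, Matrix.dotProduct_mulVec]

lemma form_self (hD : ∀ q : D, star q * q = algebraMap ℝ D (‖q‖ ^ 2)) (u : Fin k ⊕ Fin l → D) :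
    form u u = algebraMap ℝ D (∑ i, ‖u i‖ ^ 2) := by
  simp [form, dotProduct, hD]

lemma form_hermitian_sq (hD : ∀ q : D, star q * q = algebraMap ℝ D (‖q‖ ^ 2)) {M : Mat k l D}
    (hM : M.IsHermitian) (u : Fin k ⊕ Fin l → D) :
    form ((M * M).mulVec u) u = algebraMap ℝ D (∑ i, ‖M.mulVec u i‖ ^ 2) := by
  rw [← Matrix.mulVec_mulVec, form_mulVec_left, hM.eq, form_self hD]

lemma eq_zero_of_form_neg_sq (hD : ∀ q : D, star q * q = algebraMap ℝ D (‖q‖ ^ 2))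
    {M : Mat k l D} (hM : M.IsHermitian) (h : -(M * M) ∈ semiCone k l D) : M = 0 := by
  refine Matrix.ext_of_mulVec_single fun j ↦ ?_
  obtain ⟨c, hc, hcu⟩ := h.2 (Pi.single j 1)
  have h₁ : form ((-(M * M)).mulVec (Pi.single j 1)) (Pi.single j 1) =
      algebraMap ℝ D (-∑ i, ‖M.mulVec (Pi.single j 1) i‖ ^ 2) := by
    rw [map_neg, ← form_hermitian_sq hD hM, Matrix.neg_mulVec, form, form, star_neg,
      neg_dotProduct]
  rw [h₁] at hcu
  have h₂ := (algebraMap ℝ D).injective hcu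
  have h₃ : ∑ i, ‖M.mulVec (Pi.single j 1) i‖ ^ 2 = 0 :=
    le_antisymm (by linarith) (by positivity)
  rw [Finset.sum_eq_zero_iff_of_nonneg (fun _ _ ↦ by positivity)] at h₃
  ext i
  simpa using h₃ i (Finset.mem_univ i)

lemma conj_mem_semiCone {X Y : Mat k l D} (hX : X ∈ semiCone k l D) :
    Y.conjTranspose * X * Y ∈ semiCone k l D := by
  refine ⟨Matrix.isHermitian_conjTranspose_mul_mul Y hX.1, fun u ↦ ?_⟩
  obtain ⟨c, hc, hcu⟩ := hX.2 (Y.mulVec u)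
  refine ⟨c, hc, ?_⟩
  rw [← hcu, ← Matrix.mulVec_mulVec, ← Matrix.mulVec_mulVec, form_mulVec_left,
    Matrix.conjTranspose_conjTranspose]

lemma posCone_subset_semiCone : posCone k l D ⊆ semiCone k l D := by
  refine fun X hX ↦ ⟨hX.1, fun u ↦ ?_⟩
  rcases eq_or_ne u 0 with rfl | hu
  · exact ⟨0, le_rfl, by simp [form]⟩
  · obtain ⟨c, hc, h⟩ := hX.2 u hu
    exact ⟨c, hc.le, h⟩

end Form

/-! ### Positivity under a faithful *-representation. -/

section Representation

variable {k l : ℕ} {D N : Type} [NormedDivisionRing D] [NormedAlgebra ℝ D]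
    [StarRing D] [FiniteDimensional ℝ D] [Fintype N] [DecidableEq N]
    {φ : Mat k l D →⋆ₐ[ℝ] Matrix N N ℂ}

omit [FiniteDimensional ℝ D] in
lemma isSelfAdjoint_map_iff (hφ : Function.Injective φ) {X : Mat k l D} :
    IsSelfAdjoint (φ X) ↔ X.IsHermitian := by
  rw [IsSelfAdjoint, ← map_star, hφ.eq_iff]
  rfl

/-- The range is a finite-dimensional real *-subalgebra, hence closed, so real functional calculus
does not leave it. -/
lemma exists_map_eq_cfc (hφ : Function.Injective φ) (f : ℝ → ℝ) (X : Mat k l D) :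
    ∃ Y : Mat k l D, Y.IsHermitian ∧ φ Y = cfc f (φ X) := by
  have hclosed : IsClosed (φ.range : Set (Matrix N N ℂ)) :=
    (LinearMap.range φ.toAlgHom.toLinearMap).closed_of_finiteDimensional
  obtain ⟨Y, hY⟩ : cfc f (φ X) ∈ φ.range := cfc_mem (𝕜' := ℝ) (hs := hclosed) f ⟨X, rfl⟩
  have hY' : φ Y = cfc f (φ X) := hY
  exact ⟨Y, (isSelfAdjoint_map_iff hφ).1 (hY' ▸ cfc_predicate f (φ X)), hY'⟩

lemma exists_sq_eq (hφ : Function.Injective φ) {X : Mat k l D} (hX : (φ X).PosSemidef) :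
    ∃ M : Mat k l D, M.IsHermitian ∧ M * M = X := by
  obtain ⟨M, hM, hM'⟩ := exists_map_eq_cfc hφ Real.sqrt X
  refine ⟨M, hM, hφ ?_⟩
  rw [map_mul, hM', ← cfc_mul Real.sqrt Real.sqrt (φ X)]
  conv_rhs => rw [← cfc_id' ℝ (φ X) hX.isHermitian]
  refine cfc_congr fun x hx ↦ Real.mul_self_sqrt (spectrum_nonneg_of_nonneg hX.nonneg hx)

/-- Let `K` be the negative part of `X` and `M` its square root, both realized over `D`. Then `M* X
M = -K²` is positive semidefinite over `D`, which forces `K = 0`. -/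
lemma posSemidef_map_of_mem_semiCone (hD : ∀ q : D, star q * q = algebraMap ℝ D (‖q‖ ^ 2))
    (hφ : Function.Injective φ) {X : Mat k l D} (hX : X ∈ semiCone k l D) :
    (φ X).PosSemidef := by
  have hXs : IsSelfAdjoint (φ X) := (isSelfAdjoint_map_iff hφ).2 hX.1
  obtain ⟨M, hM, hM'⟩ := exists_map_eq_cfc hφ (fun x ↦ √(max (-x) 0)) X
  obtain ⟨K, hK, hK'⟩ := exists_map_eq_cfc hφ (fun x ↦ max (-x) 0) X
  have h₁ : M.conjTranspose * X * M = -(K * K) := by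
    apply hφ
    rw [hM.eq, map_mul, map_mul, map_neg, map_mul, hM', hK']
    nth_rw 2 [← cfc_id' ℝ (φ X)]
    rw [← cfc_mul .., ← cfc_mul .., ← cfc_mul .., ← cfc_neg ..]
    refine cfc_congr fun x _ ↦ ?_
    have h := Real.mul_self_sqrt (le_max_right (-x) 0)
    have h' : x * max (-x) 0 = -(max (-x) 0 * max (-x) 0) := by
      rcases le_total x 0 with hx | hx
      · rw [max_eq_left (by linarith)]; ring
      · rw [max_eq_right (by linarith)]; ring
    linear_combination h' + x * h
  have h₂ : K = 0 := eq_zero_of_form_neg_sq hD hK (h₁ ▸ conj_mem_semiCone hX)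
  have h₃ : φ X = cfc (fun x : ℝ ↦ max x 0) (φ X) := by
    rw [← sub_zero (cfc _ _), ← map_zero φ, ← h₂, hK', ← cfc_sub ..]
    conv_lhs => rw [← cfc_id' ℝ (φ X)]
    refine cfc_congr fun x _ ↦ ?_
    simp [max_zero_sub_max_neg_zero_eq_self]
  rw [← Matrix.nonneg_iff_posSemidef, h₃]
  exact cfc_nonneg fun x _ ↦ le_max_right x 0

lemma mem_semiCone_of_posSemidef_map (hD : ∀ q : D, star q * q = algebraMap ℝ D (‖q‖ ^ 2))
    (hφ : Function.Injective φ) {X : Mat k l D} (hX : (φ X).PosSemidef) :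
    X ∈ semiCone k l D := by
  obtain ⟨M, hM, rfl⟩ := exists_sq_eq hφ hX
  exact ⟨(isSelfAdjoint_map_iff hφ).1 hX.isHermitian,
    fun u ↦ ⟨_, by positivity, form_hermitian_sq hD hM u⟩⟩

omit [FiniteDimensional ℝ D] in
lemma mulVec_ne_zero_of_mem_posCone {X : Mat k l D} (hX : X ∈ posCone k l D)
    {u : Fin k ⊕ Fin l → D} (hu : u ≠ 0) : X.mulVec u ≠ 0 := by
  intro h
  obtain ⟨c, hc, hcu⟩ := hX.2 u hu
  rw [h, form, star_zero, zero_dotProduct, eq_comm, map_eq_zero] at hcu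
  exact hc.ne' hcu

/-- A definite `X` kills no nonzero column, so `Z ↦ X Z` is injective, hence bijective, on a
finite-dimensional real space. No determinant is needed, so noncommutative `D` is covered. -/
lemma isUnit_of_mem_posCone {X : Mat k l D} (hX : X ∈ posCone k l D) : IsUnit X := by
  have hinj : Function.Injective (LinearMap.mulLeft ℝ X) := by
    rw [← LinearMap.ker_eq_bot, LinearMap.ker_eq_bot']
    intro Z hZ
    by_contra hne
    obtain ⟨j, hj⟩ : ∃ j, Z.mulVec (Pi.single j 1) ≠ 0 := by
      by_contra! h
      exact hne (Matrix.ext_of_mulVec_single fun j ↦ by rw [h, Matrix.zero_mulVec])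
    apply mulVec_ne_zero_of_mem_posCone hX hj
    rw [Matrix.mulVec_mulVec]
    change X * Z = 0 at hZ
    rw [hZ, Matrix.zero_mulVec]
  obtain ⟨Z, hZ⟩ := LinearMap.injective_iff_surjective.1 hinj 1
  have hZ' : X * Z = 1 := hZ
  refine ⟨⟨X, Z, hZ', hinj ?_⟩, rfl⟩
  change X * (Z * X) = X * 1
  rw [← mul_assoc, hZ', one_mul, mul_one]

lemma posDef_map_iff (hD : ∀ q : D, star q * q = algebraMap ℝ D (‖q‖ ^ 2))
    (hφ : Function.Injective φ) (X : Mat k l D) : (φ X).PosDef ↔ X ∈ posCone k l D := by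
  constructor
  · intro hX
    refine ⟨(isSelfAdjoint_map_iff hφ).1 hX.isHermitian, fun u hu ↦ ?_⟩
    have hXs : IsSelfAdjoint (φ X) := hX.isHermitian
    -- The inverse is taken by functional calculus so that it comes from a `D`-matrix, which can act
    -- on `u`.
    obtain ⟨Y, -, hY⟩ := exists_map_eq_cfc hφ (fun x ↦ x⁻¹) X
    have hYX : Y * X = 1 := by
      apply hφ
      have hne (x : ℝ) (hx : x ∈ spectrum ℝ (φ X)) : x ≠ 0 := by
        rintro rfl; exact spectrum.zero_notMem ℝ hX.isUnit hx
      rw [map_mul, hY, map_one]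
      nth_rw 2 [← cfc_id' ℝ (φ X) hXs]
      rw [← cfc_mul _ _ _ (continuousOn_inv₀.mono hne) (by fun_prop),
        ← cfc_const_one ℝ (φ X) hXs]
      exact cfc_congr fun x hx ↦ inv_mul_cancel₀ (hne x hx)
    obtain ⟨M, hM, rfl⟩ := exists_sq_eq hφ hX.posSemidef
    refine ⟨_, ?_, form_hermitian_sq hD hM u⟩
    refine lt_of_le_of_ne (by positivity) fun h ↦ hu ?_
    rw [eq_comm, Finset.sum_eq_zero_iff_of_nonneg (fun _ _ ↦ by positivity)] at h
    have hMu : M.mulVec u = 0 := by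
      ext i
      simpa using h i (Finset.mem_univ i)
    rw [← Matrix.one_mulVec u, ← hYX, ← Matrix.mulVec_mulVec, ← Matrix.mulVec_mulVec, hMu,
      Matrix.mulVec_zero, Matrix.mulVec_zero]
  · intro hX
    rw [(posSemidef_map_of_mem_semiCone hD hφ (posCone_subset_semiCone hX)).posDef_iff_isUnit]
    exact (isUnit_of_mem_posCone hX).map φ

end Representation

/-- A faithful `*`-representation of `D`-matrices by complex matrices that preserves and reflects
positivity. -/
structure IsPositiveEmbedding {k l : ℕ} {D N : Type} [NormedDivisionRing D] [NormedAlgebra ℝ D]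
    [StarRing D] [Fintype N] [DecidableEq N] (φ : Mat k l D →⋆ₐ[ℝ] Matrix N N ℂ) : Prop where
  injective : Function.Injective φ
  posDef_iff : ∀ X, (φ X).PosDef ↔ X ∈ posCone k l D
  posSemidef_iff : ∀ X, (φ X).PosSemidef ↔ X ∈ semiCone k l D

/-! ### Transfer of J-powers and the J-order. -/

namespace IsPositiveEmbedding

variable {k l : ℕ} {D N : Type} [NormedDivisionRing D] [NormedAlgebra ℝ D]
    [StarRing D] [FiniteDimensional ℝ D] [Fintype N] [DecidableEq N]
    {φ : Mat k l D →⋆ₐ[ℝ] Matrix N N ℂ}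

lemma map_exp (φ : Mat k l D →⋆ₐ[ℝ] Matrix N N ℂ) (X : Mat k l D) :
    φ (NormedSpace.exp X) = NormedSpace.exp (φ X) := by
  have hφ : Continuous φ := φ.toAlgHom.toLinearMap.continuous_of_finiteDimensional
  have : CompleteSpace D := FiniteDimensional.complete ℝ D
  -- Any norm inducing the entrywise topology serves here; it only makes the exponential series
  -- converge.
  let _ : NormedRing (Mat k l D) := Matrix.linftyOpNormedRing
  let _ : NormedAlgebra ℝ (Mat k l D) := Matrix.linftyOpNormedAlgebra
  let _ : NormedAlgebra ℚ (Mat k l D) := NormedAlgebra.restrictScalars ℚ ℝ _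
  exact NormedSpace.map_exp φ hφ X

lemma exists_log (hφ : IsPositiveEmbedding φ) {X : Mat k l D} (hX : X ∈ posCone k l D) :
    ∃ Y : Mat k l D, Y.IsHermitian ∧ NormedSpace.exp Y = X := by
  have hpos : IsStrictlyPositive (φ X) := ((hφ.posDef_iff X).2 hX).isStrictlyPositive
  obtain ⟨Y, hY, hY'⟩ := exists_map_eq_cfc hφ.injective Real.log X
  refine ⟨Y, hY, hφ.injective ?_⟩
  rw [map_exp, hY', ← CFC.log, CFC.exp_log _ hpos]

/-- Only surjectivity of `expJ` onto the cone is used: any J-Hermitian preimage gives the same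
powers, by `map_J_mul_powJ`. -/
lemma logJ_spec (hφ : IsPositiveEmbedding φ) {X : Mat k l D} (hX : X ∈ posConeJ k l D) :
    logJ X ∈ hermJ k l D ∧ expJ (logJ X) = X := by
  obtain ⟨Y, hY, hYX⟩ := hφ.exists_log (mem_posConeJ_iff.1 hX)
  have h : ∃ Z ∈ hermJ k l D, expJ Z = X :=
    ⟨J * Y, mem_hermJ_iff.2 (by rwa [J_mul_cancel_left]), by
      rw [expJ, J_mul_cancel_left, hYX, J_mul_cancel_left]⟩
  exact ⟨Function.invFunOn_mem h, Function.invFunOn_eq h⟩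

lemma map_J_mul_powJ (hφ : IsPositiveEmbedding φ) {X : Mat k l D} (hX : X ∈ posConeJ k l D)
    (t : ℝ) : φ (J * powJ X t) = φ (J * X) ^ t := by
  obtain ⟨h₁, h₂⟩ := hφ.logJ_spec hX
  have hsa := (isSelfAdjoint_map_iff hφ.injective).2 (mem_hermJ_iff.1 h₁)
  have h₃ : φ (J * X) = NormedSpace.exp (φ (J * logJ X)) := by
    rw [← map_exp, ← J_mul_expJ, h₂]
  rw [powJ, J_mul_expJ, map_exp, mul_smul_comm, map_smul, h₃, CFC.exp_smul_eq_rpow hsa]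

omit [FiniteDimensional ℝ D] in
lemma mem_posConeJ_iff_map (hφ : IsPositiveEmbedding φ) {X : Mat k l D} :
    X ∈ posConeJ k l D ↔ IsStrictlyPositive (φ (J * X)) := by
  rw [mem_posConeJ_iff, ← hφ.posDef_iff, Matrix.isStrictlyPositive_iff_posDef]

omit [FiniteDimensional ℝ D] in
lemma leJ_iff_map (hφ : IsPositiveEmbedding φ) {X Y : Mat k l D} (hX : X ∈ posConeJ k l D)
    (hY : Y ∈ posConeJ k l D) : X ⪯ⱼ Y ↔ φ (J * X) ≤ φ (J * Y) := by
  rw [Matrix.le_iff, ← map_sub, hφ.posSemidef_iff]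
  exact ⟨fun h ↦ h.2.2, fun h ↦ ⟨hX, hY, h⟩⟩

lemma powJ_mem (hφ : IsPositiveEmbedding φ) {X : Mat k l D} (hX : X ∈ posConeJ k l D)
    (t : ℝ) : powJ X t ∈ posConeJ k l D := by
  rw [hφ.mem_posConeJ_iff_map, hφ.map_J_mul_powJ hX]
  exact (hφ.mem_posConeJ_iff_map.1 hX).rpow_const t

omit [FiniteDimensional ℝ D] in
lemma map_J_mul_mulJ (φ : Mat k l D →⋆ₐ[ℝ] Matrix N N ℂ) (X Y : Mat k l D) :
    φ (J * (X •ⱼ Y)) = φ (J * X) * φ (J * Y) := by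
  rw [mulJ, ← map_mul]
  simp only [mul_assoc]

/-- The `J`-Furuta inequality over any `D` whose matrices embed into complex matrices. -/
theorem furuta (hφ : IsPositiveEmbedding φ) {p r : ℝ} (hp : 0 ≤ p) (hr : 1 ≤ r)
    {A B : Mat k l D} (hA : A ∈ posConeJ k l D) (hB : B ∈ posConeJ k l D) (hBA : B ⪯ⱼ A) :
    powJ A (r / 2) •ⱼ powJ B p •ⱼ powJ A (r / 2) ∈ posConeJ k l D ∧
      powJ (powJ A (r / 2) •ⱼ powJ B p •ⱼ powJ A (r / 2)) (r / (r + p)) ⪯ⱼ powJ A r := by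
  have hA' := hφ.mem_posConeJ_iff_map.1 hA
  have hB' := hφ.mem_posConeJ_iff_map.1 hB
  have hmap : φ (J * (powJ A (r / 2) •ⱼ powJ B p •ⱼ powJ A (r / 2))) =
      φ (J * A) ^ (r / 2) * φ (J * B) ^ p * φ (J * A) ^ (r / 2) := by
    rw [map_J_mul_mulJ, map_J_mul_mulJ, hφ.map_J_mul_powJ hA, hφ.map_J_mul_powJ hB]
  have hmem : powJ A (r / 2) •ⱼ powJ B p •ⱼ powJ A (r / 2) ∈ posConeJ k l D := by
    rw [hφ.mem_posConeJ_iff_map, hmap]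
    exact CFC.conjugate_rpow_pos hA' hB' _ _
  refine ⟨hmem, ?_⟩
  rw [hφ.leJ_iff_map (hφ.powJ_mem hmem _) (hφ.powJ_mem hA _), hφ.map_J_mul_powJ hmem,
    hφ.map_J_mul_powJ hA, hmap]
  exact CFC.furuta hB' ((hφ.leJ_iff_map hB hA).1 hBA) hp (by linarith)

lemma of_injective (hD : ∀ q : D, star q * q = algebraMap ℝ D (‖q‖ ^ 2))
    (hφ : Function.Injective φ) : IsPositiveEmbedding φ where
  injective := hφ
  posDef_iff := posDef_map_iff hD hφ
  posSemidef_iff _ :=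
    ⟨mem_semiCone_of_posSemidef_map hD hφ, posSemidef_map_of_mem_semiCone hD hφ⟩

end IsPositiveEmbedding

/-! ### Concrete representations of the real numbers, complex numbers and quaternions. -/

/-- The entrywise extension of a complex matrix representation of `D` to matrices over `D`. -/
noncomputable def matrixRep (k l : ℕ) {D m : Type} [NormedDivisionRing D] [NormedAlgebra ℝ D] [StarRing D]
    [Fintype m] [DecidableEq m] (ρ : D →⋆ₐ[ℝ] Matrix m m ℂ) :
    Mat k l D →⋆ₐ[ℝ] Matrix ((Fin k ⊕ Fin l) × m) ((Fin k ⊕ Fin l) × m) ℂ :=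
  { (Matrix.compAlgEquiv (Fin k ⊕ Fin l) m ℂ ℝ).toAlgHom.comp ρ.toAlgHom.mapMatrix with
    map_star' := fun X ↦ by
      ext ⟨i, a⟩ ⟨j, b⟩
      change ρ (star (X j i)) a b = star (ρ (X j i) b a)
      rw [map_star]
      rfl }

lemma matrixRep_injective (k l : ℕ) {D m : Type} [NormedDivisionRing D] [NormedAlgebra ℝ D]
    [StarRing D] [Fintype m] [DecidableEq m] [Nonempty m] (ρ : D →⋆ₐ[ℝ] Matrix m m ℂ) :
    Function.Injective (matrixRep k l ρ) := by
  intro X Y h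
  ext i j
  apply (ρ : D →+* Matrix m m ℂ).injective
  ext a b
  exact congrFun (congrFun h (i, a)) (j, b)

/-- The representation of the quaternions by complex `2 × 2` matrices. -/
noncomputable def quaternionRep : ℍ[ℝ] →⋆ₐ[ℝ] Matrix (Fin 2) (Fin 2) ℂ where
  toFun q := !![⟨q.re, q.imI⟩, ⟨q.imJ, q.imK⟩; ⟨-q.imJ, q.imK⟩, ⟨q.re, -q.imI⟩]
  map_one' := by
    ext i j; fin_cases i <;> fin_cases j <;> simp [Complex.ext_iff]
  map_mul' p q := by
    ext i j; fin_cases i <;> fin_cases j <;>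
      simp [Complex.ext_iff, Matrix.mul_apply] <;> constructor <;> ring
  map_zero' := by
    ext i j; fin_cases i <;> fin_cases j <;> simp [Complex.ext_iff]
  map_add' p q := by
    ext i j; fin_cases i <;> fin_cases j <;> simp [Complex.ext_iff] <;> ring
  commutes' c := by
    ext i j; fin_cases i <;> fin_cases j <;> simp [Complex.ext_iff, Matrix.algebraMap_matrix_apply]
  map_star' q := by
    ext i j; fin_cases i <;> fin_cases j <;> simp [Complex.ext_iff]

/-- Scalar `1 × 1` matrices over `ℂ`. -/
noncomputable def complexRep : ℂ →⋆ₐ[ℝ] Matrix Unit Unit ℂ :=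
  { Algebra.ofId ℂ (Matrix Unit Unit ℂ) |>.restrictScalars ℝ with
    map_star' := fun z ↦ by
      ext i j
      simp [Matrix.algebraMap_matrix_apply] }

/-- Real scalar `1 × 1` matrices over `ℂ`. -/
noncomputable def realRep : ℝ →⋆ₐ[ℝ] Matrix Unit Unit ℂ := StarAlgHom.ofId ℝ _

end JCone

open JCone
theorem mainTheorem4 (k l : ℕ) (p r : ℝ) (hp : 0 ≤ p) (hr : 1 ≤ r) :
    -- real matrices
    (∀ A ∈ posConeJ k l ℝ, ∀ B ∈ posConeJ k l ℝ, 0 ≺ⱼ B → B ⪯ⱼ A →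
      powJ A (r / 2) •ⱼ powJ B p •ⱼ powJ A (r / 2) ∈ posConeJ k l ℝ ∧
      powJ (powJ A (r / 2) •ⱼ powJ B p •ⱼ powJ A (r / 2)) (r / (r + p)) ⪯ⱼ powJ A r) ∧
    -- complex matrices
    (∀ A ∈ posConeJ k l ℂ, ∀ B ∈ posConeJ k l ℂ, 0 ≺ⱼ B → B ⪯ⱼ A →
      powJ A (r / 2) •ⱼ powJ B p •ⱼ powJ A (r / 2) ∈ posConeJ k l ℂ ∧
      powJ (powJ A (r / 2) •ⱼ powJ B p •ⱼ powJ A (r / 2)) (r / (r + p)) ⪯ⱼ powJ A r) ∧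
    -- quaternionic matrices
    (∀ A ∈ posConeJ k l ℍ[ℝ], ∀ B ∈ posConeJ k l ℍ[ℝ], 0 ≺ⱼ B → B ⪯ⱼ A →
      powJ A (r / 2) •ⱼ powJ B p •ⱼ powJ A (r / 2) ∈ posConeJ k l ℍ[ℝ] ∧
      powJ (powJ A (r / 2) •ⱼ powJ B p •ⱼ powJ A (r / 2)) (r / (r + p)) ⪯ⱼ powJ A r) := by
  -- In each case what remains is `star q * q = ‖q‖²`, the identity behind positivity of the form.
  refine ⟨fun A hA B hB _ hBA ↦ ?_, fun A hA B hB _ hBA ↦ ?_, fun A hA B hB _ hBA ↦ ?_⟩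
  · refine (IsPositiveEmbedding.of_injective (fun q ↦ ?_)
      (matrixRep_injective k l realRep)).furuta hp hr hA hB hBA
    simp [sq]
  · refine (IsPositiveEmbedding.of_injective (fun q ↦ ?_)
      (matrixRep_injective k l complexRep)).furuta hp hr hA hB hBA
    simp [← Complex.conj_mul']
  · refine (IsPositiveEmbedding.of_injective (fun q ↦ ?_)
      (matrixRep_injective k l quaternionRep)).furuta hp hr hA hB hBA
    rw [Quaternion.star_mul_self, Quaternion.normSq_eq_norm_mul_self, sq]
    rfl
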